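/- **Setting.** Let $X_1,X_2,\dots$ be a sequence of random elements of a measurable space $\Xi$, defined on a probability space $(\Omega,\mathcal F,P)$, and $\mathbf X_n=(X_1,\dots,X_n)$. The parameter space is a product $\Theta=\prod_{j}\Theta_j$ of finitely or infinitely many measurable spaces, with a prior probability $\pi$. Every $\theta\in\Theta$ determines a probability law $F_\theta$ on $\Xi^{\mathbb N}$ (the law $P$ need not be one of them). For each $n$, the law of $\mathbf X_n$ under $P$ and the laws of the first $n$ observations under the $F_\theta$ have densities $p$ and $f_\theta$ with respect to a common $\sigma$-finite reference measure. Put $R_n(\theta)=f_\theta(\mathbf X_n)/p(\mathbf X_n)$, let the posterior be $\pi(A\mid\mathbf X_n)=\int_A f_\theta(\mathbf X_n)\,d\pi(\theta)\big/\int_\Theta f_\theta(\mathbf X_n)\,d\pi(\theta)$, and let $$h(\theta)=\lim_{n\to\infty}\tfrac1n E\log\frac{p(\mathbf X_n)}{f_\theta(\mathbf X_n)},\qquad h(A)=\operatorname*{ess\,inf}_{\theta\in A}h(\theta)\ \ (\text{w.r.t. }\pi),\qquad J(A)=h(A)-h(\Theta),\qquad I=\{h=\infty\}.$$ Assume Shalizi's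 conditions: (S1) $R_n(\theta)$ is jointly measurable in the data and $\theta$. (S2) For every $\theta$, almost surely $\frac1n\log R_n(\theta)\to-h(\theta)$. (S3) For every $\theta$ the limit $h(\theta)\in[0,\infty]$ exists, and $h$ is measurable. (S4) $\pi(I)<1$. There are measurable sets $\mathcal G_n\to\Theta$ (every $\theta$ lies in $\mathcal G_n$ for all large $n$) such that (S5) $\pi(\mathcal G_n)\ge 1-a e^{-\varsigma n}$ $(n\ge1)$ for some $a>0$ and $\varsigma>2h(\Theta)$; for each $n$ the convergence $\frac1k\log R_k(\theta)\to-h(\theta)$ as $k\to\infty$ is, almost surely, uniform in $\theta\in\mathcal G_n$ (uniform convergence in the usual sense on $\mathcal G_n\setminus I$, uniform divergence to $-\infty$ on $\mathcal G_n\cap I$); and $h(\mathcal G_n)\to h(\Theta)$. (S6) For every $\delta>0$ and every measurable $A$ with $\pi(A)>0$, almost surely, for all sufficiently large $n$ one has $n>\tau(\mathcal G_n\cap A,\delta)$. Here $\tau(B,\delta)$ is the least $t\ge0$ such that for all $k>t$ $$\tfrac1k\log\int_BR_k\,d\pi\le\max\Big\{\delta+\limsup_{j\to\infty}\tfrac1j\log\int_BR_j\,d\pi,\;-\tfrac1\delta\Big\}.$$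 (S7) $h(\mathcal G_n\cap A)\to h(A)$ for every measurable $A$ with $\pi(A)>0$. **Testing.** For $i=1,\dots,m$ ($m$ finite) test $H_{0i}:\theta_i\in\Theta_{0i}$ against $H_{1i}:\theta_i\in\Theta_{1i}=\Theta_i\setminus\Theta_{0i}$, with $\Theta_{0i}$ measurable; let $G_i\subseteq\{1,\dots,m\}$, $i\in G_i$, be given groups. For $d\in\{0,1\}^m$ ($d_i=1$: reject $H_{0i}$) let $$w_{in}(d)=\pi\Big(H_{1i}\cap\bigcap_{j\in G_i\setminus\{i\}}H_{d_jj}\,\Big|\,\mathbf X_n\Big),\qquad f_\beta(d)=\sum_{i=1}^m d_i\,(w_{in}(d)-\beta).$$ The non-marginal method with penalizing constant $\beta$ chooses $\hat d=\arg\max_d f_\beta(d)$. Assume that this is well defined asymptotically: for all sufficiently large $n$ and every $\beta\in[0,1)$, the maximizer of $f_\beta$ is $P$-almost surely unique. Put $$mpBFDR_\beta=E\left[\frac{\sum_i\hat d_i(1-w_{in}(\hat d))}{\max(\sum_i\hat d_i,1)}\;\Big|\;\hat d\ne\mathbf 0\right],$$ with the expectation taken under $P$; it depends on $n$. Let $d^t$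 be the true decision configuration: $J(\{\theta:\theta\in H_{d^t_ii}\ \forall i\le m\})=J(\Theta)$, and for every $i$, $J(H_{1i})>0$ if $d^t_i=0$ and $J(H_{0i})>0$ if $d^t_i=1$. The $i$-th null hypothesis is called true if $d^t_i=0$ and false if $d^t_i=1$. **Theorem.** Assume (B1) each group of a particular set of $m_1<m$ of the groups $G_1,\dots,G_m$ contains at least one false null hypothesis, all null hypotheses in the other $m-m_1$ groups are true, and none of these $m-m_1$ groups overlaps any of the $m_1$ groups. Suppose that $\lim_{n\to\infty}mpBFDR_{\beta=0}=E$. Let $$\alpha<E\quad\text{and}\quad\alpha\in\left(\frac1{\sum_{i=1}^md^t_i+1},\ \frac{m-m_1}{\sum_{i=1}^md^t_i+m-m_1}\right).$$ Then there is a sequence $\beta_n\in(0,1)$ with $\beta_n\to0$ and $mpBFDR_{\beta_n}\to\alpha$ as $n\to\infty$. Moreover asymptotic $\alpha$-control forces the penalty to vanish: every sequence $\beta_n\in[0,1)$ with $mpBFDR_{\beta_n}\to\alpha$ satisfies $\beta_n\to0$. -/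

import Mathlib

open Filter Topology MeasureTheory
open scoped ENNReal BigOperators

noncomputable section

/-- A Bayesian model for a data sequence `X 0, X 1, …` with values in `Ξ`, living on a probability
space `(Ω, P)`; the true law of the data need not belong to the postulated family. For every
parameter `θ`, `F θ` is the law that the model assigns to the whole sequence. For each sample
size `n`, the true law of the first `n` observations and all the model laws of the first `n`
observations have densities `p n` and `f n θ` with respect to a common reference measure `ν n`.
The prior is `π`. -/
structure BayesModel (Ω Ξ Θ : Type*) [MeasurableSpace Ω] [MeasurableSpace Ξ]
    [MeasurableSpace Θ] where
  P : Measure Ω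
  prob_P : IsProbabilityMeasure P
  X : ℕ → Ω → Ξ
  measurable_X : ∀ k, Measurable (X k)
  F : Θ → Measure (ℕ → Ξ)
  prob_F : ∀ θ, IsProbabilityMeasure (F θ)
  ν : ∀ n : ℕ, Measure (Fin n → Ξ)
  sigmaFinite_ν : ∀ n, SigmaFinite (ν n)
  p : ∀ n : ℕ, (Fin n → Ξ) → ℝ≥0∞
  measurable_p : ∀ n, Measurable (p n)
  f : ∀ n : ℕ, Θ → (Fin n → Ξ) → ℝ≥0∞
  measurable_f : ∀ n θ, Measurable (f n θ)
  law_data : ∀ n : ℕ,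
    P.map (fun ω (i : Fin n) => X i ω) = (ν n).withDensity (p n)
  law_model : ∀ (n : ℕ) (θ : Θ),
    (F θ).map (fun x (i : Fin n) => x i) = (ν n).withDensity (f n θ)
  π : Measure Θ
  prob_π : IsProbabilityMeasure π

namespace BayesModel

variable {Ω Ξ Θ : Type*} [MeasurableSpace Ω] [MeasurableSpace Ξ] [MeasurableSpace Θ]

/-- The data vector formed by the first `n` observations. -/
def data (M : BayesModel Ω Ξ Θ) (n : ℕ) (ω : Ω) : Fin n → Ξ := fun i => M.X i ω

/-- The likelihood ratio `f_θ(x) / p(x)` as a function of the data vector `x`. -/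
def ratio (M : BayesModel Ω Ξ Θ) (n : ℕ) (x : Fin n → Ξ) (θ : Θ) : ℝ≥0∞ := M.f n θ x / M.p n x

/-- The likelihood ratio `R_n(θ)` at the observed data. -/
def R (M : BayesModel Ω Ξ Θ) (n : ℕ) (ω : Ω) (θ : Θ) : ℝ≥0∞ := M.ratio n (M.data n ω) θ

/-- The posterior probability of `A` given the first `n` observations (Bayes' formula). -/
def posterior (M : BayesModel Ω Ξ Θ) (n : ℕ) (ω : Ω) (A : Set Θ) : ℝ≥0∞ :=
  (∫⁻ θ in A, M.f n θ (M.data n ω) ∂M.π) / (∫⁻ θ, M.f n θ (M.data n ω) ∂M.π)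

/-- The Kullback-Leibler divergence of the model law of the first `n` observations from their
true law, that is `E log (p(X_n) / f_θ(X_n))`. -/
def kl (M : BayesModel Ω Ξ Θ) (n : ℕ) (θ : Θ) : ℝ≥0∞ :=
  InformationTheory.klDiv (M.P.map (M.data n)) ((M.F θ).map (fun x (i : Fin n) => x i))

/-- The Kullback-Leibler divergence rate `h(θ)`. It is written as a `limsup`; that the limit
exists is part of the assumptions `ShaliziConditions`. -/
def h (M : BayesModel Ω Ξ Θ) (θ : Θ) : ℝ≥0∞ :=
  limsup (fun n : ℕ => M.kl n θ / (n : ℝ≥0∞)) atTop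

/-- `h(A)`, the essential infimum of `h` over `A` with respect to the prior. -/
def hInf (M : BayesModel Ω Ξ Θ) (A : Set Θ) : ℝ≥0∞ := essInf M.h (M.π.restrict A)

/-- `J(A) = h(A) - h(Θ)`. -/
def J (M : BayesModel Ω Ξ Θ) (A : Set Θ) : ℝ≥0∞ := M.hInf A - M.hInf Set.univ

/-- `(1 / n) log R_n(θ)`, with value `-∞` where `R_n(θ) = 0`. -/
def logRatioRate (M : BayesModel Ω Ξ Θ) (n : ℕ) (ω : Ω) (θ : Θ) : EReal :=
  ENNReal.log (M.R n ω θ) / (n : EReal)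

/-- `(1 / n) log ∫_B R_n(θ) π(dθ)`, with value `-∞` where the integral vanishes. -/
def logIntegralRate (M : BayesModel Ω Ξ Θ) (B : Set Θ) (n : ℕ) (ω : Ω) : EReal :=
  ENNReal.log (∫⁻ θ in B, M.R n ω θ ∂M.π) / (n : EReal)

/-- `t` is an admissible value at `ω` of the random time `τ(B, δ)`: from `t` on, the sequence
`(1 / k) log ∫_B R_k dπ` exceeds its upper limit by at most `δ`. If the upper limit is (close to)
`-∞`, the terms are only asked to lie below `-1 / δ`. -/
def IsTau (M : BayesModel Ω Ξ Θ) (B : Set Θ) (δ : ℝ) (ω : Ω) (t : ℕ) : Prop :=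
  ∀ k : ℕ, t < k → M.logIntegralRate B k ω ≤
    max (limsup (fun j : ℕ => M.logIntegralRate B j ω) atTop + (δ : EReal)) ((-(1 / δ) : ℝ) : EReal)

/-- The convergence of `(1 / k) log R_k(θ)` to `-h(θ)` is, almost surely, uniform over `B`
(at the points where `h` is infinite: uniform divergence to `-∞`). -/
def UniformAEP (M : BayesModel Ω Ξ Θ) (B : Set Θ) : Prop :=
  ∀ᵐ ω ∂M.P,
    (∀ ε : ℝ, 0 < ε → ∀ᶠ k : ℕ in atTop, ∀ θ ∈ B, M.h θ ≠ ⊤ →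
      -(M.h θ : EReal) - (ε : EReal) ≤ M.logRatioRate k ω θ ∧
      M.logRatioRate k ω θ ≤ -(M.h θ : EReal) + (ε : EReal)) ∧
    (∀ L : ℝ, ∀ᶠ k : ℕ in atTop, ∀ θ ∈ B, M.h θ = ⊤ → M.logRatioRate k ω θ ≤ (L : EReal))

/-- Conditions on the sieve `𝒢` (with constants `a`, `ς`). -/
structure IsSieve (M : BayesModel Ω Ξ Θ) (𝒢 : ℕ → Set Θ) (a ς : ℝ) : Prop where
  measurable : ∀ n, MeasurableSet (𝒢 n)
  tendsto_univ : ∀ θ, ∀ᶠ n in atTop, θ ∈ 𝒢 n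
  a_pos : 0 < a
  lt_ς : 2 * M.hInf Set.univ < ENNReal.ofReal ς
  prior_mass : ∀ n : ℕ, 1 ≤ n → 1 - a * Real.exp (-ς * n) ≤ M.π.real (𝒢 n)
  uniform : ∀ n, M.UniformAEP (𝒢 n)
  hInf_tendsto : Tendsto (fun n => M.hInf (𝒢 n)) atTop (𝓝 (M.hInf Set.univ))
  tau_lt : ∀ δ : ℝ, 0 < δ → ∀ A : Set Θ, MeasurableSet A → M.π A ≠ 0 →
    ∀ᵐ ω ∂M.P, ∀ᶠ n : ℕ in atTop, ∃ t : ℕ, M.IsTau (𝒢 n ∩ A) δ ω t ∧ t < n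
  hInf_inter_tendsto : ∀ A : Set Θ, MeasurableSet A → M.π A ≠ 0 →
    Tendsto (fun n => M.hInf (𝒢 n ∩ A)) atTop (𝓝 (M.hInf A))

/-- Shalizi's conditions: measurability of the likelihood ratio, the relative asymptotic
equipartition property, existence of the Kullback-Leibler divergence rate, a prior which is not
concentrated on the parameters with infinite rate, and the existence of a sieve. -/
structure ShaliziConditions (M : BayesModel Ω Ξ Θ) : Prop where
  measurable_ratio : ∀ n : ℕ,
    Measurable (fun q : (Fin n → Ξ) × Θ => M.ratio n q.1 q.2)
  aep : ∀ θ, ∀ᵐ ω ∂M.P,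
    Tendsto (fun n : ℕ => M.logRatioRate n ω θ) atTop (𝓝 (-(M.h θ : EReal)))
  kl_rate : ∀ θ, Tendsto (fun n : ℕ => M.kl n θ / (n : ℝ≥0∞)) atTop (𝓝 (M.h θ))
  measurable_h : Measurable M.h
  prior_infinite : M.π {θ | M.h θ = ⊤} < 1
  exists_sieve : ∃ (𝒢 : ℕ → Set Θ) (a ς : ℝ), M.IsSieve 𝒢 a ς

end BayesModel

/-- The multiple testing problem. The parameter `θ` has coordinates `θ j ∈ T j`, `j : ι` (finitely
or infinitely many), and `m` of them, at the positions `idx i`, are tested: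
`H_{0i} : θ (idx i) ∈ Θ₀ i` against `H_{1i} : θ (idx i) ∉ Θ₀ i`. The set `G i` is the group of
hypotheses attached to hypothesis `i`. -/
structure TestingProblem {ι : Type*} (T : ι → Type*) [∀ j, MeasurableSpace (T j)] (m : ℕ) where
  idx : Fin m ↪ ι
  Θ₀ : ∀ i : Fin m, Set (T (idx i))
  measurable_Θ₀ : ∀ i, MeasurableSet (Θ₀ i)
  G : Fin m → Finset (Fin m)
  self_mem_G : ∀ i, i ∈ G i

namespace TestingProblem

variable {Ω Ξ ι : Type*} {T : ι → Type*} [MeasurableSpace Ω] [MeasurableSpace Ξ]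
  [∀ j, MeasurableSpace (T j)] {m : ℕ}

/-- The set of parameters for which `H_{1i}` (if `b = true`), resp. `H_{0i}` (if `b = false`), is
true. -/
def H (𝒯 : TestingProblem T m) (i : Fin m) (b : Bool) : Set (∀ j, T j) :=
  {θ | b = true ↔ θ (𝒯.idx i) ∉ 𝒯.Θ₀ i}

/-- `Θ(d)`: all the decisions in the configuration `d` are correct. Here `d i = true` means that
the `i`-th null hypothesis is rejected. -/
def cell (𝒯 : TestingProblem T m) (d : Fin m → Bool) : Set (∀ j, T j) :=
  {θ | ∀ i, θ ∈ 𝒯.H i (d i)}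

/-- `dt` is the true decision configuration: `J(Θ(dt)) = J(Θ)`, and `J` is positive on each of the
hypotheses which contradict `dt`. -/
def IsTrueConfig (𝒯 : TestingProblem T m) (M : BayesModel Ω Ξ (∀ j, T j))
    (dt : Fin m → Bool) : Prop :=
  M.J (𝒯.cell dt) = M.J Set.univ ∧ ∀ i, 0 < M.J (𝒯.H i (!dt i))

/-- `w_{in}(d)`: the posterior probability that `H_{1i}` is true and that `H_{d_j, j}` is true for
all `j ∈ G_i`, `j ≠ i`. -/
def w (𝒯 : TestingProblem T m) (M : BayesModel Ω Ξ (∀ j, T j)) (n : ℕ) (ω : Ω)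
    (d : Fin m → Bool) (i : Fin m) : ℝ :=
  (M.posterior n ω {θ | θ ∈ 𝒯.H i true ∧ ∀ j ∈ 𝒯.G i, j ≠ i → θ ∈ 𝒯.H j (d j)}).toReal

/-- The number of rejected hypotheses, `∑ d_i`. -/
def numRejected (d : Fin m → Bool) : ℕ := ∑ i, (d i).toNat

/-- The criterion `f_β(d) = ∑ d_i (w_{in}(d) - β)`. -/
def criterion (𝒯 : TestingProblem T m) (M : BayesModel Ω Ξ (∀ j, T j)) (β : ℝ) (n : ℕ) (ω : Ω)
    (d : Fin m → Bool) : ℝ :=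
  ∑ i, ((d i).toNat : ℝ) * (𝒯.w M n ω d i - β)

/-- The decision configuration chosen by the non-marginal method with penalizing constant `β`:
a maximizer of `f_β` over all configurations. -/
def nonMarginal (𝒯 : TestingProblem T m) (M : BayesModel Ω Ξ (∀ j, T j)) (β : ℝ) (n : ℕ) (ω : Ω) :
    Fin m → Bool :=
  Classical.choose (Finite.exists_max (𝒯.criterion M β n ω))

theorem criterion_le_nonMarginal (𝒯 : TestingProblem T m) (M : BayesModel Ω Ξ (∀ j, T j)) (β : ℝ)
    (n : ℕ) (ω : Ω) (d : Fin m → Bool) :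
    𝒯.criterion M β n ω d ≤ 𝒯.criterion M β n ω (𝒯.nonMarginal M β n ω) :=
  Classical.choose_spec (Finite.exists_max (𝒯.criterion M β n ω)) d

/-- The configuration which maximizes `f_β` is almost surely unique for the sample size `n`. -/
def AEUniqueMax (𝒯 : TestingProblem T m) (M : BayesModel Ω Ξ (∀ j, T j)) (β : ℝ) (n : ℕ) : Prop :=
  ∀ᵐ ω ∂M.P, ∃! d : Fin m → Bool, ∀ d', 𝒯.criterion M β n ω d' ≤ 𝒯.criterion M β n ω d

/-- `δ(d | X_n)`: the indicator that the non-marginal method chooses `d`. -/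
def delta (𝒯 : TestingProblem T m) (M : BayesModel Ω Ξ (∀ j, T j)) (β : ℝ) (n : ℕ) (ω : Ω)
    (d : Fin m → Bool) : ℝ :=
  if 𝒯.nonMarginal M β n ω = d then 1 else 0

/-- The modified posterior false discovery rate of the non-marginal method. -/
def mFDR (𝒯 : TestingProblem T m) (M : BayesModel Ω Ξ (∀ j, T j)) (β : ℝ) (n : ℕ) (ω : Ω) : ℝ :=
  ∑ d : Fin m → Bool,
    (∑ i, ((d i).toNat : ℝ) * (1 - 𝒯.w M n ω d i)) / (max (numRejected d) 1 : ℕ) *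
      𝒯.delta M β n ω d

/-- The modified positive Bayesian false discovery rate of the non-marginal method: the conditional
expectation of `mFDR` under `P`, given that at least one null hypothesis is rejected. -/
def mpBFDR (𝒯 : TestingProblem T m) (M : BayesModel Ω Ξ (∀ j, T j)) (β : ℝ) (n : ℕ) : ℝ :=
  ∫ ω, 𝒯.mFDR M β n ω ∂(ProbabilityTheory.cond M.P {ω | 𝒯.delta M β n ω (fun _ => false) = 0})

/-- The grouping condition, with `S` the index set of the `m₁ < m` groups that contain a false null
hypothesis: in the groups outside `S` all null hypotheses are true, and these groups do not overlap
with the groups in `S`. -/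
def TrueNullGroupsSeparated (𝒯 : TestingProblem T m) (dt : Fin m → Bool) (S : Finset (Fin m)) : Prop :=
  S.card < m ∧
  (∀ i ∈ S, ∃ j ∈ 𝒯.G i, dt j = true) ∧
  (∀ i, i ∉ S → ∀ j ∈ 𝒯.G i, dt j = false) ∧
  (∀ i ∈ S, ∀ k, k ∉ S → Disjoint (𝒯.G i) (𝒯.G k))

end TestingProblem

end

/-!
The posterior concentrates on the true configuration `dt`. Parameters whose divergence rate is
close to the minimal one keep the integrated likelihood ratio above `exp (-c n)` for every
`c > h(Θ)`. On a set `A` with `J(A) > 0` the integral is split along the sieve: outside the sieve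
its expectation is at most the prior mass and the Borel-Cantelli lemma applies; inside the sieve
uniform convergence bounds the decay rate on each fixed sieve set, and the condition on `τ` carries
the bound over to the diagonal. Hence the posterior probability of `A` vanishes almost surely
(`BayesModel.ShaliziConditions.ae_tendsto_posterior_zero`).

Consequently, for penalties in a compact subset of `(0, 1)` the method eventually chooses `dt`
(`TestingProblem.nonMarginal_eq_of_wrongMass_lt`), and since `dt` rejects something, the error rate
tends to `0` (`TestingProblem.tendsto_mpBFDR_zero`). Since rejecting nothing has criterion `0`, the
average weight of the rejected hypotheses is at least `β`, so that the error rate is at most `1 - β`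
(`TestingProblem.mpBFDR_le_one_sub`). A positive limit of the error rate thus excludes
penalties near `1` as well as penalties in compact subsets of `(0, 1)`, which forces `β n → 0`
(`TestingProblem.tendsto_penalty_zero`).

For existence, uniqueness of the maximizer makes the chosen configuration locally constant in `β`
outside a null set, so the error rate is continuous in `β` on `[0, 1 / 2]`
(`TestingProblem.continuousOn_mpBFDR`). For large `n` it exceeds `α` at `0` and lies below `α` at
`1 / 2`, and the intermediate value theorem yields `β n` with error rate exactly `α`. These
penalties tend to `0` by the preceding paragraph.
-/

/-! ### Exponential rates in extended arithmetic -/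

lemma ENNReal.log_div_le_iff {x : ℝ≥0∞} {k : ℕ} (hk : 0 < k) (a : ℝ) :
    ENNReal.log x / (k : EReal) ≤ (a : EReal) ↔ x ≤ ENNReal.ofReal (Real.exp (a * k)) := by
  rw [EReal.div_le_iff_le_mul (by exact_mod_cast hk) (EReal.natCast_ne_top k),
    ← ENNReal.log_le_log_iff (y := ENNReal.ofReal _), ENNReal.log_ofReal_of_pos (Real.exp_pos _),
    Real.log_exp, EReal.coe_mul, mul_comm, EReal.coe_natCast]

lemma ENNReal.le_log_div_iff {x : ℝ≥0∞} {k : ℕ} (hk : 0 < k) (a : ℝ) :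
    (a : EReal) ≤ ENNReal.log x / (k : EReal) ↔ ENNReal.ofReal (Real.exp (a * k)) ≤ x := by
  rw [EReal.le_div_iff_mul_le (by exact_mod_cast hk) (EReal.natCast_ne_top k),
    ← ENNReal.log_le_log_iff (x := ENNReal.ofReal _), ENNReal.log_ofReal_of_pos (Real.exp_pos _),
    Real.log_exp, EReal.coe_mul, EReal.coe_natCast]

namespace BayesModel

variable {Ω Ξ Θ : Type*} [MeasurableSpace Ω] [MeasurableSpace Ξ] [MeasurableSpace Θ]
  {M : BayesModel Ω Ξ Θ}

/-! ### Likelihood ratios and the posterior -/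

lemma measurable_data (M : BayesModel Ω Ξ Θ) (n : ℕ) : Measurable (M.data n) :=
  measurable_pi_lambda _ fun i => M.measurable_X i

lemma map_data (M : BayesModel Ω Ξ Θ) (n : ℕ) :
    M.P.map (M.data n) = (M.ν n).withDensity (M.p n) := M.law_data n

lemma ShaliziConditions.measurable_R (hM : M.ShaliziConditions) (n : ℕ) :
    Measurable (fun q : Ω × Θ => M.R n q.1 q.2) :=
  (hM.measurable_ratio n).comp (((M.measurable_data n).comp measurable_fst).prodMk measurable_snd)

lemma ae_density_ne_zero_ne_top (M : BayesModel Ω Ξ Θ) (n : ℕ) :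
    ∀ᵐ ω ∂M.P, M.p n (M.data n ω) ≠ 0 ∧ M.p n (M.data n ω) ≠ ⊤ := by
  have := M.prob_P
  have h : ∀ᵐ x ∂(M.P.map (M.data n)), M.p n x ≠ 0 ∧ M.p n x ≠ ⊤ := by
    rw [M.map_data, ae_withDensity_iff (M.measurable_p n)]
    have hfin : ∫⁻ x, M.p n x ∂M.ν n ≠ ⊤ := by
      rw [← setLIntegral_univ, ← withDensity_apply _ MeasurableSet.univ, ← M.map_data,
        Measure.map_apply (M.measurable_data n) MeasurableSet.univ]
      exact measure_ne_top _ _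
    filter_upwards [ae_lt_top (M.measurable_p n) hfin] with x hx h0
    exact ⟨h0, hx.ne⟩
  exact ae_of_ae_map (M.measurable_data n).aemeasurable h

lemma ShaliziConditions.lintegral_R_le_one (hM : M.ShaliziConditions) (n : ℕ) (θ : Θ) :
    ∫⁻ ω, M.R n ω θ ∂M.P ≤ 1 := by
  have hm : Measurable (fun x => M.ratio n x θ) :=
    (hM.measurable_ratio n).comp (measurable_id.prodMk measurable_const)
  have := M.prob_F θ
  calc ∫⁻ ω, M.R n ω θ ∂M.P = ∫⁻ x, M.ratio n x θ ∂(M.P.map (M.data n)) :=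
        (lintegral_map hm (M.measurable_data n)).symm
    _ = ∫⁻ x, M.p n x * M.ratio n x θ ∂M.ν n := by
        rw [M.map_data, lintegral_withDensity_eq_lintegral_mul _ (M.measurable_p n) hm]; rfl
    _ ≤ ∫⁻ x, M.f n θ x ∂M.ν n := lintegral_mono fun x => ENNReal.mul_div_le
    _ = (M.F θ).map (fun x (i : Fin n) => x i) Set.univ := by
        rw [M.law_model, withDensity_apply _ MeasurableSet.univ, setLIntegral_univ]
    _ ≤ 1 := by
        rw [Measure.map_apply (by fun_prop) MeasurableSet.univ]
        exact prob_le_one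

lemma ShaliziConditions.lintegral_setLIntegral_R_le (hM : M.ShaliziConditions) (n : ℕ)
    (B : Set Θ) : ∫⁻ ω, ∫⁻ θ in B, M.R n ω θ ∂M.π ∂M.P ≤ M.π B := by
  have := M.prob_P
  have := M.prob_π
  rw [lintegral_lintegral_swap (hM.measurable_R n).aemeasurable]
  calc ∫⁻ θ in B, ∫⁻ ω, M.R n ω θ ∂M.P ∂M.π ≤ ∫⁻ _ in B, 1 ∂M.π :=
        lintegral_mono fun θ => hM.lintegral_R_le_one n θ
    _ = M.π B := by simp

lemma ShaliziConditions.measurable_setLIntegral_R (hM : M.ShaliziConditions) (n : ℕ)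
    (B : Set Θ) : Measurable fun ω => ∫⁻ θ in B, M.R n ω θ ∂M.π := by
  have := M.prob_π
  exact (hM.measurable_R n).lintegral_prod_right'

/-- Almost surely `0 < p(X_n) < ∞`, so the true density cancels in Bayes' formula. -/
lemma ae_posterior_eq (M : BayesModel Ω Ξ Θ) (n : ℕ) : ∀ᵐ ω ∂M.P, ∀ A : Set Θ,
    M.posterior n ω A = (∫⁻ θ in A, M.R n ω θ ∂M.π) / ∫⁻ θ, M.R n ω θ ∂M.π := by
  filter_upwards [M.ae_density_ne_zero_ne_top n] with ω ⟨h0, ht⟩ A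
  have hf : ∀ θ, M.f n θ (M.data n ω) = M.R n ω θ * M.p n (M.data n ω) := fun θ =>
    (ENNReal.div_mul_cancel h0 ht).symm
  simp only [posterior, hf, lintegral_mul_const' _ _ ht]
  exact ENNReal.mul_div_mul_right _ _ h0 ht

lemma ShaliziConditions.aemeasurable_posterior (hM : M.ShaliziConditions) (n : ℕ) (A : Set Θ) :
    AEMeasurable (fun ω => M.posterior n ω A) M.P := by
  have hd := hM.measurable_setLIntegral_R n Set.univ
  simp only [setLIntegral_univ] at hd
  refine ((hM.measurable_setLIntegral_R n A).div hd).aemeasurable.congr ?_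
  filter_upwards [M.ae_posterior_eq n] with ω hω
  exact (hω A).symm

lemma posterior_mono (M : BayesModel Ω Ξ Θ) (n : ℕ) (ω : Ω) {A B : Set Θ} (h : A ⊆ B) :
    M.posterior n ω A ≤ M.posterior n ω B :=
  ENNReal.div_le_div_right (lintegral_mono_set h) _

lemma posterior_le_one (M : BayesModel Ω Ξ Θ) (n : ℕ) (ω : Ω) (A : Set Θ) :
    M.posterior n ω A ≤ 1 :=
  (ENNReal.div_le_div_right (setLIntegral_le_lintegral _ _) _).trans ENNReal.div_self_le_one

lemma posterior_ne_top (M : BayesModel Ω Ξ Θ) (n : ℕ) (ω : Ω) (A : Set Θ) :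
    M.posterior n ω A ≠ ⊤ :=
  ((M.posterior_le_one n ω A).trans_lt ENNReal.one_lt_top).ne

lemma posterior_union_le (M : BayesModel Ω Ξ Θ) (n : ℕ) (ω : Ω) (A B : Set Θ) :
    M.posterior n ω (A ∪ B) ≤ M.posterior n ω A + M.posterior n ω B := by
  simp only [posterior]
  rw [← ENNReal.add_div]
  exact ENNReal.div_le_div_right (lintegral_union_le _ _ _) _

lemma posterior_iUnion_le (M : BayesModel Ω Ξ Θ) (n : ℕ) (ω : Ω) {κ : Type*} [Fintype κ]
    (A : κ → Set Θ) : M.posterior n ω (⋃ i, A i) ≤ ∑ i, M.posterior n ω (A i) := by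
  simp only [posterior, ENNReal.div_eq_inv_mul]
  rw [← Finset.mul_sum, ← tsum_fintype (L := .unconditional κ)]
  gcongr
  exact lintegral_iUnion_le _ _

/-! ### Asymptotics of the integrated likelihood ratio -/

/-- Parameters with `h < c` have positive prior mass, and the likelihood ratio of each of them
decays more slowly than `exp (-c n)`. -/
lemma ShaliziConditions.ae_eventually_exp_le_lintegral_R (hM : M.ShaliziConditions) {c : ℝ}
    (hc : M.hInf Set.univ < ENNReal.ofReal c) :
    ∀ᵐ ω ∂M.P, ∀ᶠ n : ℕ in atTop,
      ENNReal.ofReal (Real.exp (-c * n)) ≤ ∫⁻ θ, M.R n ω θ ∂M.π := by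
  have := M.prob_P
  have := M.prob_π
  obtain ⟨c', hc'0, hc', hcc⟩ := ENNReal.lt_iff_exists_real_btwn.1 hc
  have hcc' : c' < c := (ENNReal.ofReal_lt_ofReal_iff_of_nonneg hc'0).1 hcc
  have hB : M.π {θ | M.h θ < ENNReal.ofReal c'} ≠ 0 := by
    intro h0
    refine hc'.not_ge (le_essInf_of_ae_le _ ?_)
    rw [Measure.restrict_univ]
    simpa [EventuallyLE, ae_iff] using h0
  have hpt : ∀ θ, ∀ᵐ ω ∂M.P, M.h θ < ENNReal.ofReal c' →
      ∀ᶠ k : ℕ in atTop, ENNReal.ofReal (Real.exp (-c' * k)) ≤ M.R k ω θ := by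
    intro θ
    filter_upwards [hM.aep θ] with ω hω hθ
    have hlt : ((-c' : ℝ) : EReal) < -(M.h θ : EReal) := by
      rw [EReal.coe_neg, EReal.neg_lt_neg_iff]
      have := EReal.coe_ennreal_lt_coe_ennreal_iff.2 hθ
      rwa [EReal.coe_ennreal_ofReal, max_eq_left hc'0] at this
    filter_upwards [hω.eventually_const_lt hlt, eventually_gt_atTop 0] with k hk hk0
    exact (ENNReal.le_log_div_iff hk0 _).1 hk.le
  have hae : ∀ᵐ ω ∂M.P, ∀ᵐ θ ∂M.π, M.h θ < ENNReal.ofReal c' →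
      ∀ᶠ k : ℕ in atTop, ENNReal.ofReal (Real.exp (-c' * k)) ≤ M.R k ω θ := by
    rw [Measure.ae_ae_comm]
    · exact ae_of_all _ hpt
    · have h1 : MeasurableSet {x : Ω × Θ | M.h x.2 < ENNReal.ofReal c'} :=
        measurableSet_lt (hM.measurable_h.comp measurable_snd) measurable_const
      have h2 : MeasurableSet {x : Ω × Θ | ∀ᶠ k : ℕ in atTop,
          ENNReal.ofReal (Real.exp (-c' * k)) ≤ M.R k x.1 x.2} := by
        have h3 : ∀ k : ℕ, MeasurableSet {x : Ω × Θ |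
            ENNReal.ofReal (Real.exp (-c' * k)) ≤ M.R k x.1 x.2} := fun k =>
          measurableSet_le measurable_const (hM.measurable_R k)
        measurability
      exact h1.imp h2
  filter_upwards [hae] with ω hω
  -- Some threshold `N` works simultaneously for a set of parameters of positive prior mass.
  obtain ⟨N, hN⟩ : ∃ N : ℕ, M.π {θ | ∀ k ≥ N,
      ENNReal.ofReal (Real.exp (-c' * k)) ≤ M.R k ω θ} ≠ 0 := by
    by_contra! hcon
    refine hB (measure_mono_null_ae ?_ (measure_iUnion_null hcon))
    filter_upwards [hω] with θ hθ hθB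
    obtain ⟨N, hN⟩ := eventually_atTop.1 (hθ hθB)
    exact Set.mem_iUnion.2 ⟨N, hN⟩
  set r := M.π {θ | ∀ k ≥ N, ENNReal.ofReal (Real.exp (-c' * k)) ≤ M.R k ω θ} with hr
  have hrt : r ≠ ⊤ := measure_ne_top _ _
  have hlim : Tendsto (fun k : ℕ => Real.exp (-((c - c') * k))) atTop (𝓝 0) :=
    Real.tendsto_exp_neg_atTop_nhds_zero.comp
      (tendsto_natCast_atTop_atTop.const_mul_atTop (sub_pos.2 hcc'))
  filter_upwards [hlim.eventually_lt_const (ENNReal.toReal_pos hN hrt), eventually_ge_atTop N]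
    with k hk hkN
  have hRk : Measurable (fun θ => M.R k ω θ) := (hM.measurable_R k).of_uncurry_left
  calc ENNReal.ofReal (Real.exp (-c * k))
      = ENNReal.ofReal (Real.exp (-c' * k)) * ENNReal.ofReal (Real.exp (-((c - c') * k))) := by
        rw [← ENNReal.ofReal_mul (Real.exp_pos _).le, ← Real.exp_add]
        ring_nf
    _ ≤ ENNReal.ofReal (Real.exp (-c' * k)) * r := by
        gcongr
        rw [← ENNReal.ofReal_toReal hrt]
        exact ENNReal.ofReal_le_ofReal hk.le
    _ ≤ ENNReal.ofReal (Real.exp (-c' * k)) *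
          M.π {θ | ENNReal.ofReal (Real.exp (-c' * k)) ≤ M.R k ω θ} := by
        refine mul_le_mul_right (measure_mono ?_) _
        exact fun θ hθ => hθ k hkN
    _ ≤ ∫⁻ θ, M.R k ω θ ∂M.π := mul_meas_ge_le_lintegral hRk _

lemma ShaliziConditions.ae_lintegral_R_ne_top (hM : M.ShaliziConditions) (n : ℕ) :
    ∀ᵐ ω ∂M.P, ∫⁻ θ, M.R n ω θ ∂M.π ≠ ⊤ := by
  have := M.prob_π
  have h := hM.lintegral_setLIntegral_R_le n Set.univ
  have hm := hM.measurable_setLIntegral_R n Set.univ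
  simp only [setLIntegral_univ] at h hm
  filter_upwards [ae_lt_top hm (h.trans_lt (measure_lt_top _ _)).ne] with ω hω
  exact hω.ne

/-- Outside the sieve, the expected integral is at most the prior mass, and the Borel-Cantelli
lemma applies. -/
lemma ShaliziConditions.ae_eventually_setLIntegral_compl_le (hM : M.ShaliziConditions)
    {𝒢 : ℕ → Set Θ} {a ς : ℝ} (hG : M.IsSieve 𝒢 a ς) {c : ℝ} (hc : c < ς) :
    ∀ᵐ ω ∂M.P, ∀ᶠ n : ℕ in atTop,
      ∫⁻ θ in (𝒢 n)ᶜ, M.R n ω θ ∂M.π ≤ ENNReal.ofReal (Real.exp (-c * n)) := by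
  have := M.prob_π
  have hmass : ∀ n, M.π (𝒢 n)ᶜ ≤ ENNReal.ofReal ((a + 1) * Real.exp (-ς * n)) := by
    intro n
    rw [← ofReal_measureReal, probReal_compl_eq_one_sub (hG.measurable n)]
    apply ENNReal.ofReal_le_ofReal
    rcases Nat.eq_zero_or_pos n with rfl | hn
    · have := hG.a_pos
      have : 0 ≤ M.π.real (𝒢 0) := measureReal_nonneg
      simp
      linarith
    · have := hG.prior_mass n hn
      have := Real.exp_pos (-ς * n)
      linarith
  have hmarkov : ∀ n : ℕ, M.P {ω | ENNReal.ofReal (Real.exp (-c * n)) ≤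
      ∫⁻ θ in (𝒢 n)ᶜ, M.R n ω θ ∂M.π} ≤ ENNReal.ofReal ((a + 1) * Real.exp (-(ς - c)) ^ n) := by
    intro n
    refine (meas_ge_le_lintegral_div (hM.measurable_setLIntegral_R n _).aemeasurable
      (by simpa using Real.exp_pos _) ENNReal.ofReal_ne_top).trans ?_
    refine (ENNReal.div_le_div_right
      ((hM.lintegral_setLIntegral_R_le n _).trans (hmass n)) _).trans ?_
    rw [← ENNReal.ofReal_div_of_pos (Real.exp_pos _), mul_div_assoc, ← Real.exp_sub,
      ← Real.exp_nat_mul]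
    apply le_of_eq
    ring_nf
  have hsum : Summable fun n : ℕ => (a + 1) * Real.exp (-(ς - c)) ^ n :=
    (summable_geometric_of_lt_one (Real.exp_pos _).le
      (by rw [Real.exp_lt_one_iff]; linarith)).mul_left _
  have hfin : ∑' n : ℕ, M.P {ω | ENNReal.ofReal (Real.exp (-c * n)) ≤
      ∫⁻ θ in (𝒢 n)ᶜ, M.R n ω θ ∂M.π} ≠ ⊤ := by
    exact ((ENNReal.tsum_le_tsum hmarkov).trans_lt hsum.tsum_ofReal_lt_top).ne
  filter_upwards [ae_eventually_notMem hfin] with ω hω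
  filter_upwards [hω] with n hn
  exact (not_le.1 hn).le

lemma logIntegralRate_le_of_ae_logRatioRate_le {c : ℝ} {B : Set Θ} {k : ℕ} (hk : 0 < k) {ω : Ω}
    (h : ∀ᵐ θ ∂M.π.restrict B, M.logRatioRate k ω θ ≤ (c : EReal)) :
    M.logIntegralRate B k ω ≤ (c : EReal) := by
  have := M.prob_π
  refine (ENNReal.log_div_le_iff hk _).2 ?_
  calc ∫⁻ θ in B, M.R k ω θ ∂M.π
      ≤ ∫⁻ _ in B, ENNReal.ofReal (Real.exp (c * k)) ∂M.π := by
        refine lintegral_mono_ae ?_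
        filter_upwards [h] with θ hθ
        exact (ENNReal.log_div_le_iff hk _).1 hθ
    _ ≤ ENNReal.ofReal (Real.exp (c * k)) := by
        rw [setLIntegral_const]
        exact mul_le_of_le_one_right' prob_le_one

/-- On a set where the asymptotic equipartition property holds uniformly, the integrated likelihood
ratio decays at least at the rate given by the essential infimum of `h`. -/
lemma UniformAEP.ae_limsup_logIntegralRate_le {B C : Set Θ}
    (hB : M.UniformAEP B) (hC : MeasurableSet C) (hCB : C ⊆ B)
    {c : ℝ} (hc : ENNReal.ofReal c < M.hInf C) :
    ∀ᵐ ω ∂M.P, ∀ c' < c,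
      limsup (fun j : ℕ => M.logIntegralRate C j ω) atTop ≤ ((-c' : ℝ) : EReal) := by
  filter_upwards [hB] with ω ⟨hfin, htop⟩ c' hc'
  refine limsup_le_of_le (h := ?_)
  filter_upwards [hfin (c - c') (sub_pos.2 hc'), htop (-c'), eventually_gt_atTop 0]
    with k hk1 hk2 hk0
  refine logIntegralRate_le_of_ae_logRatioRate_le hk0 ?_
  filter_upwards [ae_essInf_le (f := M.h) (μ := M.π.restrict C), ae_restrict_mem hC]
    with θ hθ hθC
  by_cases hθt : M.h θ = ⊤
  · exact hk2 θ (hCB hθC) hθt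
  · refine (hk1 θ (hCB hθC) hθt).2.trans ?_
    have hlt : ((c : ℝ) : EReal) ≤ (M.h θ : EReal) := by
      refine le_trans ?_ (EReal.coe_ennreal_le_coe_ennreal_iff.2 (hc.le.trans hθ))
      rw [EReal.coe_ennreal_ofReal]
      exact_mod_cast le_max_left _ _
    calc -(M.h θ : EReal) + ((c - c' : ℝ) : EReal)
        ≤ -(c : EReal) + ((c - c' : ℝ) : EReal) := by
          gcongr
          exact EReal.neg_le_neg_iff.2 hlt
      _ = ((-c' : ℝ) : EReal) := by
          rw [← EReal.coe_neg, ← EReal.coe_add]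
          ring_nf

/-- Inside the sieve: for each fixed sieve set the decay rate is at least `h(𝒢 n ∩ A)`, and the
condition on the random time `τ` transfers this bound to the diagonal. -/
lemma IsSieve.ae_eventually_setLIntegral_inter_le {𝒢 : ℕ → Set Θ} {a ς : ℝ}
    (hG : M.IsSieve 𝒢 a ς) {A : Set Θ} (hA : MeasurableSet A) (hA0 : M.π A ≠ 0) {c : ℝ}
    (hc0 : 0 < c) (hc : ENNReal.ofReal c < M.hInf A) :
    ∀ᵐ ω ∂M.P, ∀ᶠ n : ℕ in atTop,
      ∫⁻ θ in 𝒢 n ∩ A, M.R n ω θ ∂M.π ≤ ENNReal.ofReal (Real.exp (-c * n)) := by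
  obtain ⟨c₁, hc₁0, hcc₁, hc₁⟩ := ENNReal.lt_iff_exists_real_btwn.1 hc
  have hlt : c < c₁ := (ENNReal.ofReal_lt_ofReal_iff_of_nonneg hc0.le).1 hcc₁
  obtain ⟨c₂, hc₂, hc₂₁⟩ := exists_between hlt
  -- `δ` is small enough for both terms of the maximum in the definition of `τ`.
  set δ : ℝ := min (c₂ - c) (1 / c) with hδ
  have hδ0 : 0 < δ := lt_min (sub_pos.2 hc₂) (by positivity)
  have hunif : ∀ᵐ ω ∂M.P, ∀ n, ENNReal.ofReal c₁ < M.hInf (𝒢 n ∩ A) → ∀ c' < c₁,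
      limsup (fun j : ℕ => M.logIntegralRate (𝒢 n ∩ A) j ω) atTop ≤ ((-c' : ℝ) : EReal) := by
    rw [ae_all_iff]
    intro n
    by_cases hn : ENNReal.ofReal c₁ < M.hInf (𝒢 n ∩ A)
    · filter_upwards [(hG.uniform n).ae_limsup_logIntegralRate_le
        ((hG.measurable n).inter hA) Set.inter_subset_left hn] with ω hω _ using hω
    · exact ae_of_all _ fun _ h => absurd h hn
  filter_upwards [hunif, hG.tau_lt δ hδ0 A hA hA0] with ω hω hτ
  filter_upwards [hτ, (hG.hInf_inter_tendsto A hA hA0).eventually_const_lt hc₁,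
    eventually_gt_atTop 0] with n ⟨t, ht, htn⟩ hn hn0
  refine (ENNReal.log_div_le_iff hn0 _).1 ((ht n htn).trans (max_le ?_ ?_))
  · calc limsup (fun j : ℕ => M.logIntegralRate (𝒢 n ∩ A) j ω) atTop + (δ : EReal)
        ≤ ((-c₂ : ℝ) : EReal) + ((c₂ - c : ℝ) : EReal) :=
          add_le_add (hω n hn c₂ hc₂₁) (EReal.coe_le_coe_iff.2 (min_le_left _ _))
      _ = ((-c : ℝ) : EReal) := by
          rw [← EReal.coe_add]
          ring_nf
  · rw [EReal.coe_le_coe_iff, neg_le_neg_iff, le_div_iff₀ hδ0, mul_comm, ← le_div_iff₀ hc0]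
    exact min_le_right _ _

/-- Posterior consistency: a set of parameters whose divergence rate is bounded away from the
minimal rate asymptotically carries no posterior mass. -/
theorem ShaliziConditions.ae_tendsto_posterior_zero (hM : M.ShaliziConditions) {A : Set Θ}
    (hA : MeasurableSet A) (hJ : 0 < M.J A) :
    ∀ᵐ ω ∂M.P, Tendsto (fun n => M.posterior n ω A) atTop (𝓝 0) := by
  by_cases hA0 : M.π A = 0
  · refine ae_of_all _ fun ω => ?_
    have h0 : ∀ n, M.posterior n ω A = 0 := fun n => by
      simp [posterior, Measure.restrict_eq_zero.2 hA0]
    simp [h0]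
  obtain ⟨𝒢, a, ς, hG⟩ := hM.exists_sieve
  have hς : M.hInf Set.univ < ENNReal.ofReal ς := lt_of_le_of_lt (by
    rw [two_mul]; exact le_self_add) hG.lt_ς
  obtain ⟨c, hc0, hc, hc'⟩ := ENNReal.lt_iff_exists_real_btwn.1
    (lt_min (tsub_pos_iff_lt.1 hJ) hς)
  obtain ⟨b, hb0, hb, hbc⟩ := ENNReal.lt_iff_exists_real_btwn.1 hc
  have hbc' : b < c := (ENNReal.ofReal_lt_ofReal_iff_of_nonneg hb0).1 hbc
  have hcς : c < ς :=
    (ENNReal.ofReal_lt_ofReal_iff_of_nonneg hc0).1 (hc'.trans_le (min_le_right _ _))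
  filter_upwards [hM.ae_eventually_exp_le_lintegral_R hb,
    hM.ae_eventually_setLIntegral_compl_le hG hcς,
    hG.ae_eventually_setLIntegral_inter_le hA hA0 (hb0.trans_lt hbc')
      (hc'.trans_le (min_le_left _ _)), ae_all_iff.2 M.ae_posterior_eq] with ω h1 h2 h3 h4
  have hlim : Tendsto (fun n : ℕ => ENNReal.ofReal (2 * Real.exp (-((c - b) * n))))
      atTop (𝓝 0) := by
    rw [← ENNReal.ofReal_zero, ← mul_zero (2 : ℝ)]
    exact ENNReal.tendsto_ofReal ((Real.tendsto_exp_neg_atTop_nhds_zero.comp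
      (tendsto_natCast_atTop_atTop.const_mul_atTop (sub_pos.2 hbc'))).const_mul 2)
  refine tendsto_of_tendsto_of_tendsto_of_le_of_le' tendsto_const_nhds hlim
    (Eventually.of_forall fun _ => zero_le) ?_
  filter_upwards [h1, h2, h3] with n hn1 hn2 hn3
  rw [h4 n A]
  have hsub : A ⊆ (𝒢 n ∩ A) ∪ (𝒢 n)ᶜ := fun θ hθ => by
    by_cases h : θ ∈ 𝒢 n
    exacts [Or.inl ⟨h, hθ⟩, Or.inr h]
  calc (∫⁻ θ in A, M.R n ω θ ∂M.π) / ∫⁻ θ, M.R n ω θ ∂M.π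
      ≤ (ENNReal.ofReal (Real.exp (-c * n)) + ENNReal.ofReal (Real.exp (-c * n))) /
          ENNReal.ofReal (Real.exp (-b * n)) := by
        refine ENNReal.div_le_div ?_ hn1
        exact (lintegral_mono_set hsub).trans
          ((lintegral_union_le _ _ _).trans (add_le_add hn3 hn2))
    _ = ENNReal.ofReal (2 * Real.exp (-((c - b) * n))) := by
        rw [← ENNReal.ofReal_add (Real.exp_pos _).le (Real.exp_pos _).le, ← two_mul,
          ← ENNReal.ofReal_div_of_pos (Real.exp_pos _), mul_div_assoc, ← Real.exp_sub]
        ring_nf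

lemma ShaliziConditions.hInf_univ_ne_top (hM : M.ShaliziConditions) :
    M.hInf Set.univ ≠ ⊤ := by
  obtain ⟨𝒢, a, ς, hG⟩ := hM.exists_sieve
  intro h
  have := hG.lt_ς
  simp [h] at this

/-- The normalizing constant in Bayes' formula eventually lies in `(0, ∞)`. -/
lemma ShaliziConditions.ae_eventually_posterior_univ (hM : M.ShaliziConditions) :
    ∀ᵐ ω ∂M.P, ∀ᶠ n in atTop, M.posterior n ω Set.univ = 1 := by
  obtain ⟨c, -, hc, -⟩ := ENNReal.lt_iff_exists_real_btwn.1 hM.hInf_univ_ne_top.lt_top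
  filter_upwards [hM.ae_eventually_exp_le_lintegral_R hc, ae_all_iff.2 M.ae_posterior_eq,
    ae_all_iff.2 hM.ae_lintegral_R_ne_top] with ω h1 h2 h3
  filter_upwards [h1] with n hn
  rw [h2 n, setLIntegral_univ]
  refine ENNReal.div_self (fun h0 => ?_) (h3 n)
  rw [h0] at hn
  exact (ENNReal.ofReal_pos.2 (Real.exp_pos _)).not_ge hn

end BayesModel

namespace TestingProblem

variable {Ω Ξ ι : Type*} {T : ι → Type*} [MeasurableSpace Ω] [MeasurableSpace Ξ]
  [∀ j, MeasurableSpace (T j)] {m : ℕ} {𝒯 : TestingProblem T m} {M : BayesModel Ω Ξ (∀ j, T j)}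

/-! ### Posterior probabilities of the hypotheses -/

lemma measurableSet_H (𝒯 : TestingProblem T m) (i : Fin m) (b : Bool) :
    MeasurableSet (𝒯.H i b) := by
  have h : MeasurableSet {θ : ∀ j, T j | θ (𝒯.idx i) ∉ 𝒯.Θ₀ i} :=
    (measurable_pi_apply (𝒯.idx i) (𝒯.measurable_Θ₀ i)).compl
  cases b
  · convert h.compl using 1
    ext θ
    simp [H]
  · convert h using 1
    ext θ
    simp [H]

lemma mem_H_or_mem_H_not (𝒯 : TestingProblem T m) (i : Fin m) (b : Bool) (θ : ∀ j, T j) :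
    θ ∈ 𝒯.H i b ∨ θ ∈ 𝒯.H i (!b) := by
  cases b <;> simp [H] <;> tauto

lemma w_nonneg (n : ℕ) (ω : Ω) (d : Fin m → Bool) (i : Fin m) : 0 ≤ 𝒯.w M n ω d i :=
  ENNReal.toReal_nonneg

lemma w_le_one (n : ℕ) (ω : Ω) (d : Fin m → Bool) (i : Fin m) : 𝒯.w M n ω d i ≤ 1 :=
  ENNReal.toReal_le_of_le_ofReal zero_le_one (by simpa using M.posterior_le_one n ω _)

lemma aemeasurable_w (hM : M.ShaliziConditions) (n : ℕ) (d : Fin m → Bool) (i : Fin m) :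
    AEMeasurable (fun ω => 𝒯.w M n ω d i) M.P :=
  (hM.aemeasurable_posterior n _).ennreal_toReal

lemma aemeasurable_criterion (hM : M.ShaliziConditions) (β : ℝ) (n : ℕ) (d : Fin m → Bool) :
    AEMeasurable (fun ω => 𝒯.criterion M β n ω d) M.P :=
  Finset.aemeasurable_fun_sum _ fun i _ => ((aemeasurable_w hM n d i).sub_const β).const_mul _

/-- The sum of the posterior probabilities of the hypotheses that contradict `dt`. -/
noncomputable def wrongMass (𝒯 : TestingProblem T m) (M : BayesModel Ω Ξ (∀ j, T j))
    (dt : Fin m → Bool) (n : ℕ) (ω : Ω) : ℝ :=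
  ∑ i, (M.posterior n ω (𝒯.H i (!dt i))).toReal

lemma IsTrueConfig.ae_tendsto_wrongMass {dt : Fin m → Bool} (hdt : 𝒯.IsTrueConfig M dt)
    (hM : M.ShaliziConditions) :
    ∀ᵐ ω ∂M.P, Tendsto (fun n => 𝒯.wrongMass M dt n ω) atTop (𝓝 0) := by
  have h : ∀ᵐ ω ∂M.P, ∀ i, Tendsto (fun n => M.posterior n ω (𝒯.H i (!dt i))) atTop (𝓝 0) :=
    ae_all_iff.2 fun i => hM.ae_tendsto_posterior_zero (𝒯.measurableSet_H _ _) (hdt.2 i)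
  filter_upwards [h] with ω hω
  have : Tendsto (fun n => 𝒯.wrongMass M dt n ω) atTop (𝓝 (∑ _i : Fin m, (0 : ℝ≥0∞).toReal)) :=
    tendsto_finsetSum _ fun i _ => (ENNReal.tendsto_toReal ENNReal.zero_ne_top).comp (hω i)
  simpa using this

lemma w_le_wrongMass {dt : Fin m → Bool} {i : Fin m} (hi : dt i = false) (n : ℕ) (ω : Ω)
    (d : Fin m → Bool) : 𝒯.w M n ω d i ≤ 𝒯.wrongMass M dt n ω := by
  have h1 : 𝒯.w M n ω d i ≤ (M.posterior n ω (𝒯.H i (!dt i))).toReal := by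
    refine ENNReal.toReal_mono (M.posterior_ne_top _ _ _) (M.posterior_mono _ _ ?_)
    intro θ hθ
    rw [hi]
    exact hθ.1
  exact h1.trans (Finset.single_le_sum
    (f := fun i => (M.posterior n ω (𝒯.H i (!dt i))).toReal)
    (fun _ _ => ENNReal.toReal_nonneg) (Finset.mem_univ i))

lemma one_sub_wrongMass_le_w {dt : Fin m → Bool} {i : Fin m} (hi : dt i = true) {n : ℕ} {ω : Ω}
    (h1 : M.posterior n ω Set.univ = 1) :
    1 - 𝒯.wrongMass M dt n ω ≤ 𝒯.w M n ω dt i := by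
  set A : Set (∀ j, T j) := {θ | θ ∈ 𝒯.H i true ∧ ∀ j ∈ 𝒯.G i, j ≠ i → θ ∈ 𝒯.H j (dt j)} with hA
  have hcover : (Set.univ : Set (∀ j, T j)) ⊆ A ∪ ⋃ j, 𝒯.H j (!dt j) := by
    intro θ _
    by_cases h : ∃ j, θ ∈ 𝒯.H j (!dt j)
    · exact Or.inr (Set.mem_iUnion.2 h)
    · push Not at h
      have h' : ∀ j, θ ∈ 𝒯.H j (dt j) := fun j =>
        (𝒯.mem_H_or_mem_H_not j (dt j) θ).resolve_right (h j)
      exact Or.inl ⟨hi ▸ h' i, fun j _ _ => h' j⟩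
  have hle : 1 ≤ M.posterior n ω A + ∑ j, M.posterior n ω (𝒯.H j (!dt j)) := by
    rw [← h1]
    refine (M.posterior_mono n ω hcover).trans ((M.posterior_union_le n ω _ _).trans ?_)
    gcongr
    exact M.posterior_iUnion_le n ω _
  have hfin : ∀ j ∈ Finset.univ, M.posterior n ω (𝒯.H j (!dt j)) ≠ ⊤ := fun j _ =>
    M.posterior_ne_top _ _ _
  have hle' := ENNReal.toReal_mono
    (ENNReal.add_ne_top.2 ⟨M.posterior_ne_top n ω A, ENNReal.sum_ne_top.2 hfin⟩) hle
  rw [ENNReal.toReal_add (M.posterior_ne_top n ω A) (ENNReal.sum_ne_top.2 hfin),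
    ENNReal.toReal_sum hfin, ENNReal.toReal_one] at hle'
  rw [sub_le_iff_le_add]
  exact hle'

/-! ### The maximizer of the criterion -/

/-- If the hypotheses contradicting `dt` have little posterior mass, then deviating from `dt` at a
single coordinate costs about `1 - β` (a missed rejection) or `β` (a false rejection), and agreeing
coordinates gain next to nothing. -/
lemma nonMarginal_eq_of_wrongMass_lt {dt : Fin m → Bool} {β : ℝ} {n : ℕ} {ω : Ω}
    (h1 : M.posterior n ω Set.univ = 1)
    (hβ : m * 𝒯.wrongMass M dt n ω < min β (1 - β)) : 𝒯.nonMarginal M β n ω = dt := by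
  by_contra hne
  set d := 𝒯.nonMarginal M β n ω with hd
  set q := 𝒯.wrongMass M dt n ω with hq
  have hq0 : 0 ≤ q := Finset.sum_nonneg fun _ _ => ENNReal.toReal_nonneg
  have hmin0 : 0 ≤ min β (1 - β) := (by positivity : (0 : ℝ) ≤ m * q).trans hβ.le
  obtain ⟨k, hk⟩ := Function.ne_iff.1 hne
  have hterm : ∀ i, (if i = k then min β (1 - β) else 0) - q ≤
      ((dt i).toNat : ℝ) * (𝒯.w M n ω dt i - β) - ((d i).toNat : ℝ) * (𝒯.w M n ω d i - β) := by
    intro i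
    have hl := min_le_left β (1 - β)
    have hr := min_le_right β (1 - β)
    have hw1 := w_le_one (𝒯 := 𝒯) (M := M) n ω d i
    have hite : (if i = k then min β (1 - β) else 0) ≤ min β (1 - β) := by split_ifs <;> simp [hmin0]
    have heq : d i = dt i → (if i = k then min β (1 - β) else 0) = 0 := fun h =>
      if_neg fun hik : i = k => hk (hik ▸ h)
    rcases hdti : dt i with _ | _ <;> rcases hdi : d i with _ | _
    · rw [heq (by rw [hdti, hdi])]
      simpa using hq0
    · have := w_le_wrongMass (𝒯 := 𝒯) (M := M) hdti n ω d
      simp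
      linarith
    · have := one_sub_wrongMass_le_w (𝒯 := 𝒯) (M := M) hdti h1
      simp
      linarith
    · rw [heq (by rw [hdti, hdi])]
      have := one_sub_wrongMass_le_w (𝒯 := 𝒯) (M := M) hdti h1
      simp
      linarith
  have hsum := Finset.sum_le_sum fun i (_ : i ∈ Finset.univ) => hterm i
  have hmax := 𝒯.criterion_le_nonMarginal M β n ω dt
  rw [← hd] at hmax
  simp only [criterion] at hmax
  simp only [Finset.sum_sub_distrib, Finset.sum_ite_eq', Finset.mem_univ, if_true,
    Finset.sum_const, Finset.card_univ, Fintype.card_fin, nsmul_eq_mul] at hsum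
  linarith

lemma nonMarginal_eq_of_unique {β : ℝ} {n : ℕ} {ω : Ω}
    (h : ∃! d : Fin m → Bool, ∀ d', 𝒯.criterion M β n ω d' ≤ 𝒯.criterion M β n ω d)
    (d : Fin m → Bool) :
    𝒯.nonMarginal M β n ω = d ↔ ∀ d', 𝒯.criterion M β n ω d' ≤ 𝒯.criterion M β n ω d := by
  refine ⟨fun hd => hd ▸ 𝒯.criterion_le_nonMarginal M β n ω, fun hd => ?_⟩
  exact h.unique (𝒯.criterion_le_nonMarginal M β n ω) hd

lemma continuous_criterion (n : ℕ) (ω : Ω) (d : Fin m → Bool) :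
    Continuous fun β => 𝒯.criterion M β n ω d := by
  unfold criterion
  fun_prop

/-- The chosen configuration is locally constant in the penalty wherever the maximizer is unique. -/
lemma eventually_nonMarginal_eq {β : ℝ} {n : ℕ} {ω : Ω}
    (h : ∃! d : Fin m → Bool, ∀ d', 𝒯.criterion M β n ω d' ≤ 𝒯.criterion M β n ω d) :
    ∀ᶠ b in 𝓝 β, 𝒯.nonMarginal M b n ω = 𝒯.nonMarginal M β n ω := by
  have hlt : ∀ d, d ≠ 𝒯.nonMarginal M β n ω → ∀ᶠ b in 𝓝 β,
      𝒯.criterion M b n ω d < 𝒯.criterion M b n ω (𝒯.nonMarginal M β n ω) := by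
    intro d hd
    refine (continuous_criterion n ω d).continuousAt.eventually_lt
      (continuous_criterion n ω _).continuousAt ?_
    by_contra! hge
    exact hd ((nonMarginal_eq_of_unique h d).2 fun d' =>
      (𝒯.criterion_le_nonMarginal M β n ω d').trans hge).symm
  filter_upwards [eventually_all.2 fun d => eventually_imp_distrib_left.2 (hlt d)] with b hb
  by_contra hne
  exact (hb _ hne).not_ge (𝒯.criterion_le_nonMarginal M b n ω _)

/-! ### Functionals of the chosen configuration -/

lemma AEUniqueMax.aestronglyMeasurable (hM : M.ShaliziConditions) {β : ℝ} {n : ℕ}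
    (hu : 𝒯.AEUniqueMax M β n) {φ : Ω → (Fin m → Bool) → ℝ}
    (hφ : ∀ d, AEMeasurable (fun ω => φ ω d) M.P) :
    AEStronglyMeasurable (fun ω => φ ω (𝒯.nonMarginal M β n ω)) M.P := by
  have hs : ∀ d : Fin m → Bool, NullMeasurableSet
      {ω | ∀ d', 𝒯.criterion M β n ω d' ≤ 𝒯.criterion M β n ω d} M.P := by
    intro d
    rw [Set.ofPred_forall]
    exact NullMeasurableSet.iInter fun d' =>
      nullMeasurableSet_le (aemeasurable_criterion hM β n d') (aemeasurable_criterion hM β n d)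
  have hm : AEMeasurable (fun ω => ∑ d : Fin m → Bool,
      Set.indicator {ω | ∀ d', 𝒯.criterion M β n ω d' ≤ 𝒯.criterion M β n ω d}
        (fun ω => φ ω d) ω) M.P :=
    Finset.aemeasurable_fun_sum _ fun d _ => (hφ d).indicator₀ (hs d)
  refine (hm.congr ?_).aestronglyMeasurable
  filter_upwards [hu] with ω hω
  simp only [Set.indicator_apply, Set.mem_ofPred_eq, ← nonMarginal_eq_of_unique hω]
  simp

lemma continuousOn_integral_nonMarginal (hM : M.ShaliziConditions) {n : ℕ}
    (hu : ∀ β : ℝ, 0 ≤ β → β < 1 → 𝒯.AEUniqueMax M β n) {φ : Ω → (Fin m → Bool) → ℝ}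
    (hφ : ∀ d, AEMeasurable (fun ω => φ ω d) M.P) {C : ℝ} (hC : ∀ ω d, ‖φ ω d‖ ≤ C) :
    ContinuousOn (fun β => ∫ ω, φ ω (𝒯.nonMarginal M β n ω) ∂M.P) (Set.Ico 0 1) := by
  have := M.prob_P
  intro β hβ
  refine continuousWithinAt_of_dominated (bound := fun _ => C) ?_ ?_ (integrable_const C) ?_
  · filter_upwards [self_mem_nhdsWithin] with b hb
    exact (hu b hb.1 hb.2).aestronglyMeasurable hM hφ
  · exact Eventually.of_forall fun b => ae_of_all _ fun ω => hC _ _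
  · filter_upwards [hu β hβ.1 hβ.2] with ω hω
    refine ContinuousAt.continuousWithinAt (tendsto_const_nhds.congr' ?_)
    filter_upwards [eventually_nonMarginal_eq hω] with b hb
    rw [hb]

/-- The posterior false discovery proportion of the configuration `d`. -/
noncomputable def loss (𝒯 : TestingProblem T m) (M : BayesModel Ω Ξ (∀ j, T j)) (n : ℕ) (ω : Ω)
    (d : Fin m → Bool) : ℝ :=
  (∑ i, ((d i).toNat : ℝ) * (1 - 𝒯.w M n ω d i)) / (max (numRejected d) 1 : ℕ)

/-- The indicator that `d` rejects at least one null hypothesis. -/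
def rejects (d : Fin m → Bool) : ℝ := if d = fun _ => false then 0 else 1

lemma mFDR_eq_loss (β : ℝ) (n : ℕ) (ω : Ω) :
    𝒯.mFDR M β n ω = 𝒯.loss M n ω (𝒯.nonMarginal M β n ω) := by
  simp [mFDR, loss, delta]

lemma loss_zero (n : ℕ) (ω : Ω) : 𝒯.loss M n ω (fun _ => false) = 0 := by
  simp [loss]

lemma loss_nonneg (n : ℕ) (ω : Ω) (d : Fin m → Bool) : 0 ≤ 𝒯.loss M n ω d :=
  div_nonneg (Finset.sum_nonneg fun i _ =>
    mul_nonneg (Nat.cast_nonneg _) (sub_nonneg.2 (w_le_one n ω d i))) (Nat.cast_nonneg _)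

lemma numRejected_pos {d : Fin m → Bool} (hd : d ≠ fun _ => false) : 0 < numRejected d := by
  obtain ⟨i, hi⟩ := Function.ne_iff.1 hd
  refine Finset.sum_pos' (fun _ _ => Nat.zero_le _) ⟨i, Finset.mem_univ i, ?_⟩
  rw [Bool.eq_true_of_not_eq_false hi]
  exact Nat.one_pos

lemma loss_le_of_le_sum {n : ℕ} {ω : Ω} {d : Fin m → Bool} {c : ℝ}
    (h : ∑ i, ((d i).toNat : ℝ) * (1 - 𝒯.w M n ω d i) ≤ c * numRejected d) :
    𝒯.loss M n ω d ≤ c * rejects d := by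
  by_cases hd : d = fun _ => false
  · subst hd
    simp [loss_zero, rejects]
  · have hpos := numRejected_pos hd
    have hmax : max (numRejected d) 1 = numRejected d := max_eq_left hpos
    rw [loss, hmax, rejects, if_neg hd, mul_one, div_le_iff₀ (by exact_mod_cast hpos)]
    exact h

lemma loss_le_one (n : ℕ) (ω : Ω) (d : Fin m → Bool) : 𝒯.loss M n ω d ≤ 1 := by
  have h : 𝒯.loss M n ω d ≤ 1 * rejects d := by
    refine loss_le_of_le_sum ?_
    rw [one_mul, numRejected, Nat.cast_sum]
    refine Finset.sum_le_sum fun i _ => mul_le_of_le_one_right (Nat.cast_nonneg _) ?_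
    linarith [w_nonneg (𝒯 := 𝒯) (M := M) n ω d i]
  refine h.trans ?_
  unfold rejects
  split_ifs <;> norm_num

/-- The maximal value of the criterion is nonnegative, since rejecting nothing gives `0`; hence
the rejected hypotheses have average weight at least `β`. -/
lemma loss_nonMarginal_le (β : ℝ) (n : ℕ) (ω : Ω) :
    𝒯.loss M n ω (𝒯.nonMarginal M β n ω) ≤ (1 - β) * rejects (𝒯.nonMarginal M β n ω) := by
  refine loss_le_of_le_sum ?_
  have h := 𝒯.criterion_le_nonMarginal M β n ω (fun _ => false)
  set d := 𝒯.nonMarginal M β n ω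
  have h0 : 𝒯.criterion M β n ω (fun _ => false) = 0 := by simp [criterion]
  rw [h0, criterion] at h
  rw [numRejected, Nat.cast_sum, Finset.mul_sum, ← sub_nonneg, ← Finset.sum_sub_distrib]
  refine h.trans (Finset.sum_le_sum fun i _ => ?_)
  linarith

lemma aemeasurable_loss (hM : M.ShaliziConditions) (n : ℕ) (d : Fin m → Bool) :
    AEMeasurable (fun ω => 𝒯.loss M n ω d) M.P :=
  (Finset.aemeasurable_fun_sum _ fun i _ =>
    ((aemeasurable_w hM n d i).const_sub 1).const_mul _).div_const _

lemma norm_loss_le_one (n : ℕ) (ω : Ω) (d : Fin m → Bool) : ‖𝒯.loss M n ω d‖ ≤ 1 := by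
  rw [Real.norm_of_nonneg (loss_nonneg n ω d)]
  exact loss_le_one n ω d

lemma norm_rejects_le_one (d : Fin m → Bool) : ‖rejects d‖ ≤ 1 := by
  unfold rejects
  split_ifs <;> simp

lemma rejects_nonneg (d : Fin m → Bool) : 0 ≤ rejects d := by
  unfold rejects
  split_ifs <;> simp

/-! ### The error rate as a function of the penalty -/

lemma mpBFDR_eq_div (hM : M.ShaliziConditions) {β : ℝ} {n : ℕ} (hu : 𝒯.AEUniqueMax M β n) :
    𝒯.mpBFDR M β n = (∫ ω, 𝒯.loss M n ω (𝒯.nonMarginal M β n ω) ∂M.P) /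
      ∫ ω, rejects (𝒯.nonMarginal M β n ω) ∂M.P := by
  set s : Set Ω := {ω | 𝒯.delta M β n ω (fun _ => false) = 0} with hs
  have hmem : ∀ ω, ω ∈ s ↔ 𝒯.nonMarginal M β n ω ≠ fun _ => false := fun ω => by
    simp [hs, delta]
  have hind : (fun ω => rejects (𝒯.nonMarginal M β n ω)) = s.indicator 1 := by
    funext ω
    by_cases h : 𝒯.nonMarginal M β n ω = fun _ => false
    · rw [Set.indicator_of_notMem (fun hω => (hmem ω).1 hω h), rejects, if_pos h]
    · rw [Set.indicator_of_mem ((hmem ω).2 h), rejects, if_neg h, Pi.one_apply]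
  have hnull : NullMeasurableSet s M.P := by
    have h1 := hu.aestronglyMeasurable hM (φ := fun _ d => rejects d) fun _ => aemeasurable_const
    have h2 : s = {ω | rejects (𝒯.nonMarginal M β n ω) = 1} := by
      ext ω
      rw [hmem]
      simp [rejects]
    rw [h2]
    exact h1.aemeasurable.nullMeasurable (measurableSet_singleton 1)
  have hden : ∫ ω, rejects (𝒯.nonMarginal M β n ω) ∂M.P = M.P.real s := by
    rw [hind, integral_indicator₀ hnull]
    simp
  rw [mpBFDR, ProbabilityTheory.cond, integral_smul_measure, hden, ENNReal.toReal_inv,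
    smul_eq_mul, mul_comm, ← div_eq_mul_inv, setIntegral_eq_integral_of_forall_compl_eq_zero]
  · simp only [mFDR_eq_loss, Measure.real, ← hs]
  · intro ω hω
    rw [hmem, not_not] at hω
    rw [mFDR_eq_loss, hω, loss_zero]

lemma integrable_loss_nonMarginal (hM : M.ShaliziConditions) {β : ℝ} {n : ℕ}
    (hu : 𝒯.AEUniqueMax M β n) :
    Integrable (fun ω => 𝒯.loss M n ω (𝒯.nonMarginal M β n ω)) M.P := by
  have := M.prob_P
  exact Integrable.of_bound (hu.aestronglyMeasurable hM (aemeasurable_loss hM n)) 1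
    (ae_of_all _ fun ω => norm_loss_le_one n ω _)

lemma integrable_rejects_nonMarginal (hM : M.ShaliziConditions) {β : ℝ} {n : ℕ}
    (hu : 𝒯.AEUniqueMax M β n) :
    Integrable (fun ω => rejects (𝒯.nonMarginal M β n ω)) M.P := by
  have := M.prob_P
  exact Integrable.of_bound (hu.aestronglyMeasurable hM (φ := fun _ d => rejects d)
    fun _ => aemeasurable_const) 1 (ae_of_all _ fun ω => norm_rejects_le_one _)

lemma mpBFDR_le_one_sub (hM : M.ShaliziConditions) {β : ℝ} {n : ℕ} (hβ : β ≤ 1)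
    (hu : 𝒯.AEUniqueMax M β n) : 𝒯.mpBFDR M β n ≤ 1 - β := by
  rw [mpBFDR_eq_div hM hu]
  refine div_le_of_le_mul₀ (integral_nonneg fun ω => rejects_nonneg _) (sub_nonneg.2 hβ) ?_
  rw [← integral_const_mul]
  exact integral_mono (integrable_loss_nonMarginal hM hu)
    ((integrable_rejects_nonMarginal hM hu).const_mul _) fun ω => loss_nonMarginal_le β n ω

/-- With a larger penalty fewer data sets lead to a rejection, because the criterion decreases in
the penalty. -/
lemma rejects_nonMarginal_anti {β b : ℝ} (hβb : β ≤ b) {n : ℕ} {ω : Ω}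
    (hu : ∃! d : Fin m → Bool, ∀ d', 𝒯.criterion M b n ω d' ≤ 𝒯.criterion M b n ω d) :
    rejects (𝒯.nonMarginal M b n ω) ≤ rejects (𝒯.nonMarginal M β n ω) := by
  by_cases h : 𝒯.nonMarginal M β n ω = fun _ => false
  · have h0 : ∀ c, 𝒯.criterion M c n ω (fun _ => false) = 0 := fun c => by simp [criterion]
    have hb : 𝒯.nonMarginal M b n ω = fun _ => false := by
      rw [nonMarginal_eq_of_unique hu]
      intro d
      have h1 := 𝒯.criterion_le_nonMarginal M β n ω d
      rw [h, h0] at h1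
      rw [h0]
      refine le_trans (Finset.sum_le_sum fun i _ => ?_) h1
      exact mul_le_mul_of_nonneg_left (by linarith) (Nat.cast_nonneg _)
    rw [h, hb]
  · rw [rejects, rejects, if_neg h]
    split_ifs <;> norm_num

lemma continuousOn_mpBFDR (hM : M.ShaliziConditions) {n : ℕ}
    (hu : ∀ β : ℝ, 0 ≤ β → β < 1 → 𝒯.AEUniqueMax M β n) {b : ℝ} (hb : b < 1)
    (hpos : 0 < ∫ ω, rejects (𝒯.nonMarginal M b n ω) ∂M.P) :
    ContinuousOn (fun β => 𝒯.mpBFDR M β n) (Set.Icc 0 b) := by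
  have hsub : Set.Icc 0 b ⊆ Set.Ico (0 : ℝ) 1 := fun β hβ => ⟨hβ.1, hβ.2.trans_lt hb⟩
  have hcont := ((continuousOn_integral_nonMarginal hM hu
    (φ := fun ω d => 𝒯.loss M n ω d) (aemeasurable_loss hM n) (norm_loss_le_one n)).mono
    hsub).div ((continuousOn_integral_nonMarginal hM hu
    (φ := fun _ d => rejects d) (fun _ => aemeasurable_const)
    (fun _ d => norm_rejects_le_one d)).mono hsub) ?_
  · exact hcont.congr fun β hβ => mpBFDR_eq_div hM (hu β (hsub hβ).1 (hsub hβ).2)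
  · intro β hβ
    have hb0 : 0 ≤ b := hβ.1.trans hβ.2
    refine (hpos.trans_le ?_).ne'
    refine integral_mono_ae (integrable_rejects_nonMarginal hM (hu b hb0 hb))
      (integrable_rejects_nonMarginal hM (hu β (hsub hβ).1 (hsub hβ).2)) ?_
    filter_upwards [hu b hb0 hb] with ω hω
    exact rejects_nonMarginal_anti hβ.2 hω

/-! ### Penalties bounded away from `0` and `1` -/

section Limits

variable {dt : Fin m → Bool} {b c : ℝ} {β : ℕ → ℝ}

lemma ae_eventually_nonMarginal_eq (hM : M.ShaliziConditions) (hdt : 𝒯.IsTrueConfig M dt)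
    (hb : 0 < b) (hc : c < 1) (hβ : ∀ n, b ≤ β n ∧ β n ≤ c) :
    ∀ᵐ ω ∂M.P, ∀ᶠ n in atTop, 𝒯.nonMarginal M (β n) n ω = dt := by
  filter_upwards [hM.ae_eventually_posterior_univ, hdt.ae_tendsto_wrongMass hM] with ω h1 h2
  have h3 : Tendsto (fun n => m * 𝒯.wrongMass M dt n ω) atTop (𝓝 0) := by
    simpa using h2.const_mul (m : ℝ)
  filter_upwards [h1, h3.eventually_lt_const (lt_min hb (sub_pos.2 hc))] with n hn1 hn2
  refine nonMarginal_eq_of_wrongMass_lt hn1 (hn2.trans_le (min_le_min (hβ n).1 ?_))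
  linarith [(hβ n).2]

lemma ae_tendsto_loss (hM : M.ShaliziConditions) (hdt : 𝒯.IsTrueConfig M dt) :
    ∀ᵐ ω ∂M.P, Tendsto (fun n => 𝒯.loss M n ω dt) atTop (𝓝 0) := by
  filter_upwards [hM.ae_eventually_posterior_univ, hdt.ae_tendsto_wrongMass hM] with ω h1 h2
  have hrej : rejects dt ≤ 1 := (le_abs_self _).trans (norm_rejects_le_one dt)
  refine tendsto_of_tendsto_of_tendsto_of_le_of_le' tendsto_const_nhds
    (by simpa using h2.mul_const (rejects dt)) (Eventually.of_forall fun n => loss_nonneg n ω dt) ?_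
  filter_upwards [h1] with n hn
  refine loss_le_of_le_sum ?_
  rw [numRejected, Nat.cast_sum, Finset.mul_sum]
  refine Finset.sum_le_sum fun i _ => ?_
  rcases hi : dt i with _ | _
  · simp
  · have := one_sub_wrongMass_le_w (𝒯 := 𝒯) (M := M) hi hn
    simp
    linarith

lemma tendsto_integral_rejects (hM : M.ShaliziConditions) (hdt : 𝒯.IsTrueConfig M dt)
    (hunique : ∀ᶠ n : ℕ in atTop, ∀ β : ℝ, 0 ≤ β → β < 1 → 𝒯.AEUniqueMax M β n)
    (hb : 0 < b) (hc : c < 1) (hβ : ∀ n, b ≤ β n ∧ β n ≤ c) :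
    Tendsto (fun n => ∫ ω, rejects (𝒯.nonMarginal M (β n) n ω) ∂M.P) atTop (𝓝 (rejects dt)) := by
  have := M.prob_P
  have h : Tendsto (fun n => ∫ ω, rejects (𝒯.nonMarginal M (β n) n ω) ∂M.P) atTop
      (𝓝 (∫ _, rejects dt ∂M.P)) := by
    refine tendsto_integral_filter_of_dominated_convergence (fun _ => 1) ?_ ?_
      (integrable_const 1) ?_
    · filter_upwards [hunique] with n hn
      exact (integrable_rejects_nonMarginal hM (hn _ (hb.le.trans (hβ n).1)
        ((hβ n).2.trans_lt hc))).aestronglyMeasurable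
    · exact Eventually.of_forall fun n => ae_of_all _ fun ω => norm_rejects_le_one _
    · filter_upwards [ae_eventually_nonMarginal_eq hM hdt hb hc hβ] with ω hω
      refine tendsto_const_nhds.congr' ?_
      filter_upwards [hω] with n hn
      rw [hn]
  simpa using h

lemma tendsto_mpBFDR_zero (hM : M.ShaliziConditions) (hdt : 𝒯.IsTrueConfig M dt)
    (hdt0 : dt ≠ fun _ => false)
    (hunique : ∀ᶠ n : ℕ in atTop, ∀ β : ℝ, 0 ≤ β → β < 1 → 𝒯.AEUniqueMax M β n)
    (hb : 0 < b) (hc : c < 1) (hβ : ∀ n, b ≤ β n ∧ β n ≤ c) :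
    Tendsto (fun n => 𝒯.mpBFDR M (β n) n) atTop (𝓝 0) := by
  have := M.prob_P
  have hu : ∀ᶠ n in atTop, 𝒯.AEUniqueMax M (β n) n := by
    filter_upwards [hunique] with n hn
    exact hn _ (hb.le.trans (hβ n).1) ((hβ n).2.trans_lt hc)
  have hnum : Tendsto (fun n => ∫ ω, 𝒯.loss M n ω (𝒯.nonMarginal M (β n) n ω) ∂M.P) atTop
      (𝓝 (∫ _, (0 : ℝ) ∂M.P)) := by
    refine tendsto_integral_filter_of_dominated_convergence (fun _ => 1) ?_ ?_
      (integrable_const 1) ?_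
    · filter_upwards [hu] with n hn
      exact (integrable_loss_nonMarginal hM hn).aestronglyMeasurable
    · exact Eventually.of_forall fun n => ae_of_all _ fun ω => norm_loss_le_one n ω _
    · filter_upwards [ae_eventually_nonMarginal_eq hM hdt hb hc hβ, ae_tendsto_loss hM hdt]
        with ω hω hl
      refine hl.congr' ?_
      filter_upwards [hω] with n hn
      rw [hn]
  have hden := tendsto_integral_rejects hM hdt hunique hb hc hβ
  rw [rejects, if_neg hdt0] at hden
  have h := hnum.div hden one_ne_zero
  simp only [integral_zero, zero_div] at h
  refine h.congr' ?_
  filter_upwards [hu] with n hn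
  exact (mpBFDR_eq_div hM hn).symm

/-- A positive limit of the error rate forces the penalty to vanish: penalties near `1` are excluded
by the bound `mpBFDR ≤ 1 - β`, and penalties bounded away from `0` and `1` give the limit `0`. -/
lemma tendsto_penalty_zero (hM : M.ShaliziConditions) (hdt : 𝒯.IsTrueConfig M dt)
    (hdt0 : dt ≠ fun _ => false)
    (hunique : ∀ᶠ n : ℕ in atTop, ∀ β : ℝ, 0 ≤ β → β < 1 → 𝒯.AEUniqueMax M β n)
    {α : ℝ} (hα : 0 < α) (hβ : ∀ n, 0 ≤ β n ∧ β n < 1)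
    (hlim : Tendsto (fun n : ℕ => 𝒯.mpBFDR M (β n) n) atTop (𝓝 α)) :
    Tendsto β atTop (𝓝 0) := by
  rw [tendsto_order]
  refine ⟨fun a ha => Eventually.of_forall fun n => ha.trans_le (hβ n).1, fun b hb => ?_⟩
  -- `β n` is compared with its clamped version in `[b', max b' (1 - α / 2)]`, a compact subset
  -- of `(0, 1)`, where the error rate tends to `0`.
  obtain ⟨b', hb'0, hb'⟩ := exists_between (lt_min hb one_pos)
  have hb'1 : b' < 1 := hb'.trans_le (min_le_right _ _)
  have hc : max b' (1 - α / 2) < 1 := max_lt hb'1 (by linarith)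
  have hclamp := tendsto_mpBFDR_zero (β := fun n => max b' (min (β n) (1 - α / 2))) hM hdt hdt0
    hunique hb'0 hc fun n => ⟨le_max_left _ _, max_le_max le_rfl (min_le_right _ _)⟩
  filter_upwards [hclamp.eventually_lt_const (half_pos hα),
    hlim.eventually_const_lt (half_lt_self hα), hunique] with n h1 h2 h3
  by_contra! hge
  have h4 := mpBFDR_le_one_sub hM (hβ n).2.le (h3 _ (hβ n).1 (hβ n).2)
  have h5 : max b' (min (β n) (1 - α / 2)) = β n := by
    rw [min_eq_left (by linarith), max_eq_right ((hb'.trans_le (min_le_left _ _)).le.trans hge)]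
  rw [h5] at h1
  linarith

end Limits

end TestingProblem

/-! ### Solving for the penalty -/

theorem mainTheorem7 {Ω Ξ ι : Type*} {T : ι → Type*} [MeasurableSpace Ω] [MeasurableSpace Ξ]
    [∀ j, MeasurableSpace (T j)] {m : ℕ}
    (M : BayesModel Ω Ξ (∀ j, T j)) (hM : M.ShaliziConditions)
    (𝒯 : TestingProblem T m)
    (dt : Fin m → Bool) (hdt : 𝒯.IsTrueConfig M dt)
    (S : Finset (Fin m)) (hgroups : 𝒯.TrueNullGroupsSeparated dt S)
    (hunique : ∀ᶠ n : ℕ in atTop, ∀ β : ℝ, 0 ≤ β → β < 1 → 𝒯.AEUniqueMax M β n)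
    (E : ℝ) (hE : Tendsto (fun n : ℕ => 𝒯.mpBFDR M 0 n) atTop (𝓝 E))
    (α : ℝ) (hαE : α < E)
    (hα_lower : 1 / ((TestingProblem.numRejected dt : ℝ) + 1) < α)
    (hα_upper : α < ((m : ℝ) - (S.card : ℝ)) /
      ((TestingProblem.numRejected dt : ℝ) + (m : ℝ) - (S.card : ℝ))) :
    (∃ β : ℕ → ℝ, (∀ n, 0 < β n ∧ β n < 1) ∧ Tendsto β atTop (𝓝 0) ∧
      Tendsto (fun n : ℕ => 𝒯.mpBFDR M (β n) n) atTop (𝓝 α)) ∧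
    (∀ β : ℕ → ℝ, (∀ n, 0 ≤ β n ∧ β n < 1) →
      Tendsto (fun n : ℕ => 𝒯.mpBFDR M (β n) n) atTop (𝓝 α) → Tendsto β atTop (𝓝 0)) := by
  have hk : 0 < (m : ℝ) - (S.card : ℝ) := sub_pos.2 (by exact_mod_cast hgroups.1)
  have hα : 0 < α := lt_trans (by positivity) hα_lower
  -- Without a false null hypothesis both endpoints of the interval for `α` would be `1`.
  have hdt0 : dt ≠ fun _ => false := by
    rintro rfl
    have h0 : TestingProblem.numRejected (fun _ : Fin m => false) = 0 := by
      simp [TestingProblem.numRejected]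
    rw [h0, Nat.cast_zero, zero_add, div_one] at hα_lower
    rw [h0, Nat.cast_zero, zero_add, div_self hk.ne'] at hα_upper
    exact lt_asymm hα_lower hα_upper
  have hforce : ∀ β : ℕ → ℝ, (∀ n, 0 ≤ β n ∧ β n < 1) →
      Tendsto (fun n : ℕ => 𝒯.mpBFDR M (β n) n) atTop (𝓝 α) → Tendsto β atTop (𝓝 0) :=
    fun β => TestingProblem.tendsto_penalty_zero hM hdt hdt0 hunique hα
  refine ⟨?_, hforce⟩
  have hhalf : ∀ _ : ℕ, (1 / 2 : ℝ) ≤ 1 / 2 ∧ (1 / 2 : ℝ) ≤ 1 / 2 := fun _ => ⟨le_rfl, le_rfl⟩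
  have hrej := TestingProblem.tendsto_integral_rejects (β := fun _ => 1 / 2) hM hdt hunique
    one_half_pos one_half_lt_one hhalf
  rw [TestingProblem.rejects, if_neg hdt0] at hrej
  have hzero := TestingProblem.tendsto_mpBFDR_zero (β := fun _ => 1 / 2) hM hdt hdt0 hunique
    one_half_pos one_half_lt_one hhalf
  have hsolve : ∀ᶠ n in atTop, ∃ β : ℝ, (0 < β ∧ β < 1) ∧ 𝒯.mpBFDR M β n = α := by
    filter_upwards [hrej.eventually_const_lt one_pos, hzero.eventually_lt_const hα,
      hE.eventually_const_lt hαE, hunique] with n h1 h2 h3 h4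
    obtain ⟨β, hβ, hval⟩ := intermediate_value_Icc' one_half_pos.le
      (TestingProblem.continuousOn_mpBFDR hM h4 one_half_lt_one h1) ⟨h2.le, h3.le⟩
    refine ⟨β, ⟨lt_of_le_of_ne hβ.1 ?_, hβ.2.trans_lt one_half_lt_one⟩, hval⟩
    rintro rfl
    exact h3.ne' hval
  have hchoice : ∀ n, ∃ β : ℝ, (0 < β ∧ β < 1) ∧
      ((∃ β : ℝ, (0 < β ∧ β < 1) ∧ 𝒯.mpBFDR M β n = α) → 𝒯.mpBFDR M β n = α) := by
    intro n
    by_cases h : ∃ β : ℝ, (0 < β ∧ β < 1) ∧ 𝒯.mpBFDR M β n = α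
    · obtain ⟨β, hβ, hval⟩ := h
      exact ⟨β, hβ, fun _ => hval⟩
    · exact ⟨1 / 2, ⟨one_half_pos, one_half_lt_one⟩, fun h' => absurd h' h⟩
  choose β hβ hval using hchoice
  have hlim : Tendsto (fun n : ℕ => 𝒯.mpBFDR M (β n) n) atTop (𝓝 α) := by
    refine tendsto_const_nhds.congr' ?_
    filter_upwards [hsolve] with n hn
    exact (hval n hn).symm
  exact ⟨β, hβ, hforce β (fun n => ⟨(hβ n).1.le, (hβ n).2⟩) hlim, hlim⟩
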